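/- Let $d\ge 0$ and let $G=(V,E)$ be a simple undirected graph that is periodic: the group $\mathbb{Z}^d$ acts freely on $V$, the set of orbits $V/\mathbb{Z}^d$ is finite, and $\{gu,gw\}\in E$ for all $\{u,w\}\in E$ and $g\in\mathbb{Z}^d$. Let $v_0\in V$, and assume that every vertex in the connected component of $v_0$ has finite degree (for example, that $G$ is locally finite, or equivalently that $E/\mathbb{Z}^d$ is finite). For $k\ge 0$ let $c_k$ be the number of vertices $v\in V$ such that the length of a shortest path from $v_0$ to $v$ equals $k$. Then every $c_k$ is finite, and the generating function $\sum_{k\ge 0} c_k z^k$ is rational: there are polynomials $p_1,p_2\in\mathbb{Q}[z]$ with $p_2\neq 0$ such that $p_2(z)\sum_{k\ge 0} c_k z^k=p_1(z)$ as formal power series. -/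

import Mathlib

/-- A graph `G` on a vertex set `V` carrying an action of `ℤ^d` is periodic if the action is free,
has finitely many orbits on the vertices, and maps edges to edges. -/
structure IsPeriodicGraph (d : ℕ) {V : Type*} [AddAction (Fin d → ℤ) V] (G : SimpleGraph V) :
    Prop where
  free : ∀ (g : Fin d → ℤ) (v : V), g +ᵥ v = v → g = 0
  finite_orbits : Finite (AddAction.orbitRel.Quotient (Fin d → ℤ) V)
  adj_vadd : ∀ (g : Fin d → ℤ) (u w : V), G.Adj u w → G.Adj (g +ᵥ u) (g +ᵥ w)

/-- The set of vertices whose shortest path from `v₀` has length exactly `k`. The extended distance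
is `⊤` for vertices that cannot be reached from `v₀`, so these are in no sphere. -/
def SimpleGraph.sphereAt {V : Type*} (G : SimpleGraph V) (v₀ : V) (k : ℕ) : Set V :=
  {v | G.edist v₀ v = (k : ℕ∞)}

/-- The coordination sequence of `G` from `v₀`. -/
noncomputable def SimpleGraph.coordinationSequence {V : Type*} (G : SimpleGraph V) (v₀ : V)
    (k : ℕ) : ℕ :=
  (G.sphereAt v₀ k).ncard

/-- The generating function `∑ c_k z^k` of a sequence of natural numbers, as a formal power
series. -/
noncomputable def generatingFunction (c : ℕ → ℕ) : PowerSeries ℚ :=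
  PowerSeries.mk fun k => (c k : ℚ)

/-- A formal power series `f` is rational if `f = p₁ / p₂` for polynomials `p₁` and `p₂ ≠ 0`. -/
def PowerSeries.IsRational {K : Type*} [Field K] (f : PowerSeries K) : Prop :=
  ∃ p₁ p₂ : Polynomial K, p₂ ≠ 0 ∧ (p₂ : PowerSeries K) * f = (p₁ : PowerSeries K)

/-!
For a vertex `r`, consider the pairs `(g, k)` of a translation and a number such that `g +ᵥ r` has
distance at most `k` from `v₀`. Every long walk contains a short block between two vertices of one
orbit whose removal, followed by a translation of the rest of the walk, does not change the set of
orbits that are met. As translations commute, conversely such a block can be inserted wherever its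
orbit is met. Hence the pairs form a finite union of sets `F + M`, with `F` finite, coming from the
short walks, and `M` the submonoid generated by the finitely many blocks: a semilinear set.

A semilinear set with finite levels has a rational growth series. Finite unions of translates of
one finitely generated submonoid are closed under intersection by Dickson's lemma, so by
inclusion–exclusion it suffices to treat `F + M`, and there an induction on the generators of `M`
works as for Hilbert series of graded modules. A sphere, finally, is the difference of two balls.
-/

open scoped Pointwise Polynomial PowerSeries

section RationalSeries

variable {K : Type*} [Field K]

/-- The rational power series over a field, as a subalgebra over the polynomials: rational series
are closed under sums, products and multiplication by polynomials. -/
def rationalSeries (K : Type*) [Field K] : Subalgebra K[X] K⟦X⟧ where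
  carrier := {f | f.IsRational}
  mul_mem' := by
    rintro f g ⟨p, q, hq, hf⟩ ⟨p', q', hq', hg⟩
    refine ⟨p * p', q * q', mul_ne_zero hq hq', ?_⟩
    rw [Polynomial.coe_mul, Polynomial.coe_mul, ← hf, ← hg]
    ring
  add_mem' := by
    rintro f g ⟨p, q, hq, hf⟩ ⟨p', q', hq', hg⟩
    refine ⟨q' * p + q * p', q * q', mul_ne_zero hq hq', ?_⟩
    simp only [Polynomial.coe_mul, Polynomial.coe_add, ← hf, ← hg]
    ring
  algebraMap_mem' p := ⟨p, 1, one_ne_zero, by rw [Polynomial.coe_one, one_mul]; rfl⟩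

theorem coe_mem_rationalSeries (p : K[X]) : (p : K⟦X⟧) ∈ rationalSeries K :=
  (rationalSeries K).algebraMap_mem p

theorem mem_rationalSeries_of_coe_mul_mem {p : K[X]} (hp : p ≠ 0) {f : K⟦X⟧}
    (h : (p : K⟦X⟧) * f ∈ rationalSeries K) : f ∈ rationalSeries K := by
  obtain ⟨p₁, p₂, hp₂, hf⟩ := h
  exact ⟨p₁, p₂ * p, mul_ne_zero hp₂ hp, by rw [Polynomial.coe_mul, mul_assoc, hf]⟩

theorem X_pow_mul_mem_rationalSeries {f : K⟦X⟧} (hf : f ∈ rationalSeries K) (n : ℕ) :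
    PowerSeries.X ^ n * f ∈ rationalSeries K := by
  rw [← Polynomial.coe_X, ← Polynomial.coe_pow]
  exact mul_mem (coe_mem_rationalSeries _) hf

theorem mem_rationalSeries_of_eq_add_X_pow_mul {n : ℕ} (hn : 0 < n) {f g : K⟦X⟧}
    (hg : g ∈ rationalSeries K) (h : f = g + PowerSeries.X ^ n * f) : f ∈ rationalSeries K := by
  refine mem_rationalSeries_of_coe_mul_mem
    (neg_ne_zero.2 (Polynomial.X_pow_sub_C_ne_zero hn (1 : K))) ?_
  convert hg using 1
  rw [Polynomial.coe_neg, Polynomial.coe_sub, Polynomial.coe_pow, Polynomial.coe_X, map_one,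
    Polynomial.coe_one]
  linear_combination h

theorem mem_rationalSeries_of_recursion {n : ℕ} (hn : 0 < n) {f : ℕ → K⟦X⟧}
    (hf : ∀ j, ∃ g ∈ rationalSeries K, f j = g + PowerSeries.X ^ n * f (j + 1)) {J : ℕ}
    (hJ : f (J + 1) = f J) : f 0 ∈ rationalSeries K := by
  refine Nat.decreasingInduction (motive := fun j _ => f j ∈ rationalSeries K) (fun j _ hj => ?_)
    ?_ J.zero_le
  · obtain ⟨g, hg, h⟩ := hf j
    rw [h]
    exact add_mem hg (X_pow_mul_mem_rationalSeries hj n)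
  · obtain ⟨g, hg, h⟩ := hf J
    rw [hJ] at h
    exact mem_rationalSeries_of_eq_add_X_pow_mul hn hg h

end RationalSeries

section Growth

variable {α β : Type*} {deg : α → ℕ} {s t : Set α}

/-- The degree function `deg` has finite fibres on the set `s`, so that `growthSeries deg s` counts
the elements of `s` by degree. -/
def HasFiniteLevels (deg : α → ℕ) (s : Set α) : Prop :=
  ∀ k, (s ∩ deg ⁻¹' {k}).Finite

/-- The series `∑ x ∈ s, X ^ deg x`. It is meaningful if `HasFiniteLevels deg s`: the levels are
counted by `Set.ncard`, which is `0` on infinite sets. -/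
noncomputable def growthSeries (deg : α → ℕ) (s : Set α) : ℚ⟦X⟧ :=
  generatingFunction fun k => (s ∩ deg ⁻¹' {k}).ncard

/-- The elements of `s` are counted by `deg` into a rational series. -/
structure HasRationalGrowth (deg : α → ℕ) (s : Set α) : Prop where
  hasFiniteLevels : HasFiniteLevels deg s
  growthSeries_mem : growthSeries deg s ∈ rationalSeries ℚ

theorem coeff_growthSeries (deg : α → ℕ) (s : Set α) (k : ℕ) :
    PowerSeries.coeff k (growthSeries deg s) = ((s ∩ deg ⁻¹' {k}).ncard : ℚ) := by
  rw [growthSeries, generatingFunction, PowerSeries.coeff_mk]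

theorem HasFiniteLevels.mono (ht : HasFiniteLevels deg t) (hst : s ⊆ t) : HasFiniteLevels deg s :=
  fun k => (ht k).subset (Set.inter_subset_inter_left _ hst)

theorem HasFiniteLevels.union (hs : HasFiniteLevels deg s) (ht : HasFiniteLevels deg t) :
    HasFiniteLevels deg (s ∪ t) := fun k => by
  rw [Set.union_inter_distrib_right]
  exact (hs k).union (ht k)

theorem HasFiniteLevels.finite_of_finite_image (hs : HasFiniteLevels deg s)
    (h : (deg '' s).Finite) : s.Finite :=
  Set.Finite.of_finite_fibers deg h fun k _ => hs k

theorem growthSeries_union_add_inter (hs : HasFiniteLevels deg s) (ht : HasFiniteLevels deg t) :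
    growthSeries deg (s ∪ t) + growthSeries deg (s ∩ t) =
      growthSeries deg s + growthSeries deg t := by
  ext k
  simp only [map_add, coeff_growthSeries, Set.union_inter_distrib_right,
    Set.inter_inter_distrib_right s t]
  exact_mod_cast Set.ncard_union_add_ncard_inter _ _ (hs k) (ht k)

theorem growthSeries_empty (deg : α → ℕ) : growthSeries deg ∅ = 0 := by
  ext k
  simp [coeff_growthSeries]

theorem growthSeries_union (hs : HasFiniteLevels deg s) (ht : HasFiniteLevels deg t)
    (hst : Disjoint s t) :
    growthSeries deg (s ∪ t) = growthSeries deg s + growthSeries deg t := by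
  rw [← growthSeries_union_add_inter hs ht, hst.inter_eq, growthSeries_empty, add_zero]

theorem growthSeries_singleton (deg : α → ℕ) (x : α) :
    growthSeries deg {x} = PowerSeries.X ^ deg x := by
  ext k
  rw [coeff_growthSeries, PowerSeries.coeff_X_pow]
  rcases eq_or_ne k (deg x) with rfl | h
  · simp
  · simp [h, Ne.symm h, Set.singleton_inter_eq_empty.2]

variable {deg' : β → ℕ} {f : α → β} {c : ℕ}

theorem image_inter_preimage_add (hdeg : ∀ x ∈ s, deg' (f x) = deg x + c) (k : ℕ) :
    f '' s ∩ deg' ⁻¹' {k + c} = f '' (s ∩ deg ⁻¹' {k}) := by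
  ext y
  constructor
  · rintro ⟨⟨x, hx, rfl⟩, hk⟩
    exact ⟨x, ⟨hx, Nat.add_right_cancel ((hdeg x hx).symm.trans hk)⟩, rfl⟩
  · rintro ⟨x, ⟨hx, rfl⟩, rfl⟩
    exact ⟨⟨x, hx, rfl⟩, hdeg x hx⟩

theorem image_inter_preimage_of_lt (hdeg : ∀ x ∈ s, deg' (f x) = deg x + c) {k : ℕ} (hk : k < c) :
    f '' s ∩ deg' ⁻¹' {k} = ∅ := by
  refine Set.eq_empty_of_forall_notMem ?_
  rintro _ ⟨⟨x, hx, rfl⟩, hxk⟩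
  have h : deg x + c = k := (hdeg x hx).symm.trans hxk
  omega

theorem HasFiniteLevels.image (hs : HasFiniteLevels deg s)
    (hdeg : ∀ x ∈ s, deg' (f x) = deg x + c) : HasFiniteLevels deg' (f '' s) := fun k => by
  rcases lt_or_ge k c with hk | hk
  · simp only [image_inter_preimage_of_lt hdeg hk, Set.finite_empty]
  · obtain ⟨k, rfl⟩ := Nat.exists_eq_add_of_le' hk
    rw [image_inter_preimage_add hdeg]
    exact (hs k).image f

theorem growthSeries_image (hf : Set.InjOn f s) (hdeg : ∀ x ∈ s, deg' (f x) = deg x + c) :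
    growthSeries deg' (f '' s) = PowerSeries.X ^ c * growthSeries deg s := by
  ext k
  rw [PowerSeries.coeff_X_pow_mul', coeff_growthSeries]
  split_ifs with hk
  · obtain ⟨k, rfl⟩ := Nat.exists_eq_add_of_le' hk
    rw [image_inter_preimage_add hdeg, (hf.mono Set.inter_subset_left).ncard_image,
      Nat.add_sub_cancel, coeff_growthSeries]
  · rw [image_inter_preimage_of_lt hdeg (not_le.1 hk), Set.ncard_empty, Nat.cast_zero]

namespace HasRationalGrowth

theorem empty (deg : α → ℕ) : HasRationalGrowth deg ∅ :=
  ⟨fun _ => by simp, by rw [growthSeries_empty]; exact zero_mem _⟩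

theorem singleton (deg : α → ℕ) (x : α) : HasRationalGrowth deg {x} where
  hasFiniteLevels _ := (Set.finite_singleton x).subset Set.inter_subset_left
  growthSeries_mem := by
    rw [growthSeries_singleton, ← mul_one (PowerSeries.X ^ _)]
    exact X_pow_mul_mem_rationalSeries (one_mem _) _

theorem union_of_inter (hs : HasRationalGrowth deg s) (ht : HasRationalGrowth deg t)
    (hst : HasRationalGrowth deg (s ∩ t)) : HasRationalGrowth deg (s ∪ t) where
  hasFiniteLevels := hs.hasFiniteLevels.union ht.hasFiniteLevels
  growthSeries_mem := by
    rw [eq_sub_of_add_eq (growthSeries_union_add_inter hs.hasFiniteLevels ht.hasFiniteLevels)]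
    exact sub_mem (add_mem hs.growthSeries_mem ht.growthSeries_mem) hst.growthSeries_mem

theorem union (hs : HasRationalGrowth deg s) (ht : HasRationalGrowth deg t) (hst : Disjoint s t) :
    HasRationalGrowth deg (s ∪ t) :=
  hs.union_of_inter ht (by rw [hst.inter_eq]; exact empty deg)

theorem sdiff (hs : HasRationalGrowth deg s) (ht : HasRationalGrowth deg t) (hts : t ⊆ s) :
    HasRationalGrowth deg (s \ t) where
  hasFiniteLevels := hs.hasFiniteLevels.mono Set.sdiff_subset
  growthSeries_mem := by
    have h := growthSeries_union (hs.hasFiniteLevels.mono Set.sdiff_subset) ht.hasFiniteLevels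
      (Set.disjoint_sdiff_left (s := t) (t := s))
    rw [Set.sdiff_union_of_subset hts] at h
    rw [eq_sub_of_add_eq h.symm]
    exact sub_mem hs.growthSeries_mem ht.growthSeries_mem

theorem image (hs : HasRationalGrowth deg s) (hf : Set.InjOn f s)
    (hdeg : ∀ x ∈ s, deg' (f x) = deg x + c) : HasRationalGrowth deg' (f '' s) where
  hasFiniteLevels := hs.hasFiniteLevels.image hdeg
  growthSeries_mem := by
    rw [growthSeries_image hf hdeg]
    exact X_pow_mul_mem_rationalSeries hs.growthSeries_mem c

theorem of_finite (deg : α → ℕ) (hs : s.Finite) : HasRationalGrowth deg s := by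
  induction s, hs using Set.Finite.induction_on with
  | empty => exact empty deg
  | insert hx _ ih => exact (singleton deg _).union ih (Set.disjoint_singleton_left.2 hx)

theorem iUnion_of_pairwise_disjoint {ι : Type*} [Finite ι] {A : ι → Set α}
    (hA : ∀ i, HasRationalGrowth deg (A i)) (hdisj : Pairwise (Function.onFun Disjoint A)) :
    HasRationalGrowth deg (⋃ i, A i) := by
  have key (I : Set ι) (hI : I.Finite) : HasRationalGrowth deg (⋃ i ∈ I, A i) := by
    induction I, hI using Set.Finite.induction_on with
    | empty => simpa only [Set.biUnion_empty] using empty deg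
    | insert hi _ ih =>
      rw [Set.biUnion_insert]
      exact (hA _).union ih
        (Set.disjoint_iUnion₂_right.2 fun j hj => hdisj (ne_of_mem_of_not_mem hj hi).symm)
  simpa only [Set.biUnion_univ] using key Set.univ Set.finite_univ

theorem sUnion_of_inter {C : Set α → Prop} (hC : ∀ s, C s → HasRationalGrowth deg s)
    (hinter : ∀ s t, C s → C t → C (s ∩ t)) {𝒜 : Set (Set α)} (h𝒜 : 𝒜.Finite)
    (hC𝒜 : ∀ s ∈ 𝒜, C s) : HasRationalGrowth deg (⋃₀ 𝒜) := by
  suffices ∀ I : Set (Set α), I.Finite → ∀ φ : Set α → Set α, (∀ s ∈ I, C (φ s)) →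
      HasRationalGrowth deg (⋃ s ∈ I, φ s) by
    rw [Set.sUnion_eq_biUnion]
    exact this 𝒜 h𝒜 id hC𝒜
  intro I hI
  induction I, hI using Set.Finite.induction_on with
  | empty => exact fun _ _ => by simpa only [Set.biUnion_empty] using empty deg
  | @insert s I _ _ ih =>
    intro φ hφ
    have hs := hφ s (Set.mem_insert s I)
    have hI : ∀ t ∈ I, C (φ t) := fun t ht => hφ t (Set.mem_insert_of_mem s ht)
    rw [Set.biUnion_insert]
    refine (hC _ hs).union_of_inter (ih φ hI) ?_
    rw [Set.inter_iUnion₂]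
    exact ih (fun t => φ s ∩ φ t) fun t ht => hinter _ _ hs (hI t ht)

end HasRationalGrowth

end Growth

section FiniteGeneration

variable {Γ : Type*} [AddCommMonoid Γ] {M N : AddSubmonoid Γ} {A B C F : Set Γ}

theorem finite_setOf_minimal {α : Type*} [PartialOrder α] [WellQuasiOrderedLE α] (s : Set α) :
    {x | Minimal (· ∈ s) x}.Finite :=
  WellQuasiOrderedLE.finite_of_isAntichain (setOfPred_minimal_antichain _)

/-- For a translate of `M` this is Dickson's lemma, applied to exponents of generators of `M`. -/
theorem exists_finite_subset_add_of_subset_add (hM : M.FG) (hF : F.Finite)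
    (hC : C ⊆ F + (M : Set Γ)) : ∃ I ⊆ C, I.Finite ∧ C ⊆ I + (M : Set Γ) := by
  obtain ⟨n, φ, rfl⟩ := AddSubmonoid.fg_iff_exists_fin_addMonoidHom.1 hM
  refine ⟨⋃ f ∈ F, (fun u => f + φ u) '' {u | Minimal (· ∈ (fun u => f + φ u) ⁻¹' C) u}, ?_,
    hF.biUnion fun f _ => (finite_setOf_minimal _).image _, fun x hx => ?_⟩
  · simp only [Set.iUnion_subset_iff, Set.image_subset_iff]
    exact fun f _ u hu => hu.prop
  · obtain ⟨f, hf, _, ⟨u, rfl⟩, rfl⟩ := hC hx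
    obtain ⟨v, hvu, hv⟩ :=
      exists_minimal_le_of_wellFoundedLT (· ∈ (fun u => f + φ u) ⁻¹' C) u hx
    obtain ⟨w, rfl⟩ := exists_add_of_le hvu
    exact ⟨f + φ v, Set.mem_biUnion hf ⟨v, hv, rfl⟩, φ w, ⟨w, rfl⟩, by
      simp only [map_add, add_assoc]⟩

theorem exists_forall_inter_subset_of_monotone (hM : M.FG) (hF : F.Finite) {C : ℕ → Set Γ}
    (hmono : Monotone C) (hC : ∀ j, C j + (M : Set Γ) ⊆ C j) :
    ∃ J, ∀ j, (F + (M : Set Γ)) ∩ C j ⊆ C J := by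
  obtain ⟨I, hIC, hI, hCI⟩ := exists_finite_subset_add_of_subset_add hM hF
    (C := ⋃ j, (F + (M : Set Γ)) ∩ C j) (Set.iUnion_subset fun _ => Set.inter_subset_left)
  have hIC' (a) (ha : a ∈ I) : ∃ j, a ∈ C j :=
    (Set.mem_iUnion.1 (hIC ha)).imp fun _ h => h.2
  choose! ν hν using hIC'
  obtain ⟨J, hJ⟩ := (hI.image ν).bddAbove
  refine ⟨J, fun j x hx => ?_⟩
  obtain ⟨a, ha, m, hm, rfl⟩ := hCI (Set.mem_iUnion.2 ⟨j, hx⟩)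
  exact hC J (Set.add_mem_add (hmono (hJ (Set.mem_image_of_mem ν ha)) (hν a ha)) hm)

theorem fg_inf_of_fg [IsCancelAdd Γ] (hM : M.FG) (hN : N.FG) : (M ⊓ N).FG := by
  obtain ⟨m, φ, rfl⟩ := AddSubmonoid.fg_iff_exists_fin_addMonoidHom.1 hM
  obtain ⟨n, ψ, rfl⟩ := AddSubmonoid.fg_iff_exists_fin_addMonoidHom.1 hN
  have h := (AddSubmonoid.fg_eqLocusM (φ.comp (AddMonoidHom.fst _ _))
    (ψ.comp (AddMonoidHom.snd (Fin m → ℕ) (Fin n → ℕ)))).map (φ.comp (AddMonoidHom.fst _ _))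
  convert h
  ext x
  constructor
  · rintro ⟨⟨u, rfl⟩, v, hv⟩
    exact ⟨(u, v), hv.symm, rfl⟩
  · rintro ⟨⟨u, v⟩, huv, rfl⟩
    exact ⟨⟨u, rfl⟩, v, huv.symm⟩

/-- A finite union of translates of one finitely generated submonoid. Unlike the linear sets, which
are single translates, these sets are closed under intersection. -/
def IsFGTranslateSet (A : Set Γ) : Prop :=
  ∃ (F : Set Γ) (M : AddSubmonoid Γ), F.Finite ∧ M.FG ∧ A = F + (M : Set Γ)

theorem IsFGTranslateSet.of_isLinearSet (hA : IsLinearSet A) : IsFGTranslateSet A := by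
  obtain ⟨a, M, hM, rfl⟩ := isLinearSet_iff_exists_fg_eq_vadd.1 hA
  exact ⟨{a}, M, Set.finite_singleton a, hM, by rw [Set.singleton_add]; rfl⟩

theorem IsFGTranslateSet.inter [IsCancelAdd Γ] (hA : IsFGTranslateSet A)
    (hB : IsFGTranslateSet B) : IsFGTranslateSet (A ∩ B) := by
  obtain ⟨F, M, hF, hM, rfl⟩ := hA
  obtain ⟨E, N, hE, hN, rfl⟩ := hB
  have hdiag : (fun x => (x, x)) '' ((F + (M : Set Γ)) ∩ (E + (N : Set Γ))) ⊆
      F ×ˢ E + (M.prod N : Set (Γ × Γ)) := by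
    rintro _ ⟨x, ⟨⟨f, hf, m, hm, hx⟩, e, he, n, hn, hx'⟩, rfl⟩
    exact ⟨(f, e), ⟨hf, he⟩, (m, n), ⟨hm, hn⟩, Prod.ext hx hx'⟩
  obtain ⟨I, hI, hIfin, hdiagI⟩ :=
    exists_finite_subset_add_of_subset_add (hM.prod hN) (hF.prod hE) hdiag
  refine ⟨Prod.fst '' I, M ⊓ N, hIfin.image _, fg_inf_of_fg hM hN,
    Set.Subset.antisymm (fun x hx => ?_) ?_⟩
  · obtain ⟨a, ha, ⟨m, n⟩, ⟨hm, hn⟩, hamn⟩ := hdiagI ⟨x, hx, rfl⟩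
    obtain ⟨y, -, rfl⟩ := hI ha
    obtain ⟨rfl, h⟩ := Prod.mk.inj hamn
    obtain rfl : n = m := add_left_cancel h
    exact ⟨y, ⟨_, ha, rfl⟩, n, ⟨hm, hn⟩, rfl⟩
  · rintro _ ⟨_, ⟨a, ha, rfl⟩, m, ⟨hmM, hmN⟩, rfl⟩
    obtain ⟨y, ⟨⟨f, hf, l, hl, rfl⟩, e, he, n, hn, heq⟩, rfl⟩ := hI ha
    refine ⟨⟨f, hf, l + m, add_mem hl hmM, (add_assoc _ _ _).symm⟩,
      e, he, n + m, add_mem hn hmN, ?_⟩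
    simp only [← heq, add_assoc]

end FiniteGeneration

section SemilinearGrowth

variable {Γ : Type*} [AddCommMonoid Γ] {deg : Γ →+ ℕ}

theorem add_closure_insert (F T : Set Γ) (t : Γ) :
    F + (AddSubmonoid.closure (insert t T) : Set Γ) =
      F + (AddSubmonoid.closure {t} : Set Γ) + (AddSubmonoid.closure T : Set Γ) := by
  rw [Set.insert_eq, AddSubmonoid.closure_union, AddSubmonoid.coe_sup, add_assoc]

theorem add_closure_insert_eq_union (F T : Set Γ) (t : Γ) :
    F + (AddSubmonoid.closure (insert t T) : Set Γ) =
      (F + (AddSubmonoid.closure T : Set Γ)) ∪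
        (t + ·) '' (F + (AddSubmonoid.closure (insert t T) : Set Γ)) := by
  have ht : t ∈ AddSubmonoid.closure (insert t T) :=
    AddSubmonoid.subset_closure (Set.mem_insert t T)
  refine Set.Subset.antisymm ?_ (Set.union_subset
    (Set.add_subset_add_left (AddSubmonoid.closure_mono (Set.subset_insert t T))) ?_)
  · rw [add_closure_insert]
    rintro _ ⟨_, ⟨f, hf, m, hm, rfl⟩, m', hm', rfl⟩
    obtain ⟨k, rfl⟩ := AddSubmonoid.mem_closure_singleton.1 hm
    cases k with
    | zero => exact Or.inl ⟨f, hf, m', hm', by simp⟩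
    | succ k =>
      refine Or.inr ⟨f + k • t + m', ?_, ?_⟩
      · exact ⟨_, ⟨f, hf, _, AddSubmonoid.mem_closure_singleton.2 ⟨k, rfl⟩, rfl⟩, m', hm', rfl⟩
      · simp only [succ_nsmul]
        abel
  · rintro _ ⟨_, ⟨f, hf, m, hm, rfl⟩, rfl⟩
    exact ⟨f, hf, t + m, add_mem ht hm, add_left_comm f t m⟩

theorem growthSeries_sdiff_eq_add [IsCancelAdd Γ] {N N₀ : Set Γ} {t : Γ}
    (hN : HasFiniteLevels deg N) (h : N = N₀ ∪ (t + ·) '' N) (C : Set Γ) :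
    growthSeries deg (N \ C) = growthSeries deg (N₀ \ (C ∪ (t + ·) '' N)) +
      PowerSeries.X ^ deg t * growthSeries deg (N \ (t + ·) ⁻¹' C) := by
  have hsplit : N \ C = (N₀ \ (C ∪ (t + ·) '' N)) ∪ (t + ·) '' (N \ (t + ·) ⁻¹' C) := by
    rw [Set.image_sdiff_preimage]
    nth_rw 1 [h]
    grind
  have hfin := hN.mono (Set.sdiff_subset (t := C))
  rw [hsplit] at hfin ⊢
  rw [growthSeries_union (hfin.mono Set.subset_union_left) (hfin.mono Set.subset_union_right),
    growthSeries_image (add_right_injective t).injOn fun x _ => ?_]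
  · rw [map_add, add_comm]
  · exact Set.disjoint_sdiff_left.mono_right ((Set.image_mono Set.sdiff_subset).trans
      Set.subset_union_right)

/-- Cutting off the translates by multiples of `t` gives a chain of sets which is stationary, since
`N` is Noetherian; at a stationary member the recursion for the growth series becomes an equation,
which is solved by dividing by `1 - X ^ deg t`. -/
theorem growthSeries_sdiff_mem_of_deg_pos [IsCancelAdd Γ] {F T : Set Γ} {t : Γ} (hF : F.Finite)
    (hT : T.Finite) (ht : 0 < deg t)
    (hN : HasFiniteLevels deg (F + (AddSubmonoid.closure (insert t T) : Set Γ)))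
    (ih : ∀ C : Set Γ, C + (AddSubmonoid.closure T : Set Γ) ⊆ C →
      growthSeries deg ((F + (AddSubmonoid.closure T : Set Γ)) \ C) ∈ rationalSeries ℚ)
    {C : Set Γ} (hC : C + (AddSubmonoid.closure (insert t T) : Set Γ) ⊆ C) :
    growthSeries deg ((F + (AddSubmonoid.closure (insert t T) : Set Γ)) \ C) ∈
      rationalSeries ℚ := by
  set M := AddSubmonoid.closure (insert t T)
  have htM : t ∈ M := AddSubmonoid.subset_closure (Set.mem_insert t T)
  have hTM : AddSubmonoid.closure T ≤ M := AddSubmonoid.closure_mono (Set.subset_insert t T)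
  have hMM : F + (M : Set Γ) = _ := add_closure_insert_eq_union F T t
  let D (j : ℕ) : Set Γ := (j • t + ·) ⁻¹' C
  have hDsucc (j : ℕ) : (t + ·) ⁻¹' D j = D (j + 1) := by
    ext x
    simp only [D, Set.mem_preimage, succ_nsmul, add_assoc]
  have hD (j : ℕ) : D j + (M : Set Γ) ⊆ D j := by
    rintro _ ⟨x, hx, m, hm, rfl⟩
    exact hC ⟨_, hx, m, hm, add_assoc _ _ _⟩
  have hDmono : Monotone D := monotone_nat_of_le_succ fun j x hx => by
    rw [← hDsucc, Set.mem_preimage, add_comm]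
    exact hD j ⟨x, hx, t, htM, rfl⟩
  have hrec (j : ℕ) : ∃ p ∈ rationalSeries ℚ, growthSeries deg ((F + (M : Set Γ)) \ D j) =
      p + PowerSeries.X ^ deg t * growthSeries deg ((F + (M : Set Γ)) \ D (j + 1)) := by
    refine ⟨_, ih (D j ∪ (t + ·) '' (F + (M : Set Γ))) ?_, ?_⟩
    · rw [Set.union_add]
      refine Set.union_subset_union
        ((Set.add_subset_add_left hTM).trans (hD j)) ?_
      rintro _ ⟨_, ⟨_, ⟨f, hf, m, hm, rfl⟩, rfl⟩, m', hm', rfl⟩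
      exact ⟨_, ⟨f, hf, m + m', add_mem hm (hTM hm'), rfl⟩, by simp only [add_assoc]⟩
    · rw [← hDsucc]
      exact growthSeries_sdiff_eq_add hN hMM (D j)
  obtain ⟨J, hJ⟩ := exists_forall_inter_subset_of_monotone
    ((AddSubmonoid.fg_iff _).2 ⟨_, rfl, hT.insert t⟩) hF hDmono hD
  have hJsucc : (F + (M : Set Γ)) \ D (J + 1) = (F + (M : Set Γ)) \ D J :=
    (Set.sdiff_subset_sdiff_right (hDmono J.le_succ)).antisymm
      fun x hx => ⟨hx.1, fun hxJ => hx.2 (hJ _ ⟨hx.1, hxJ⟩)⟩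
  have h := mem_rationalSeries_of_recursion ht hrec (congrArg (growthSeries deg) hJsucc)
  simpa only [D, zero_nsmul, zero_add, Set.preimage_id'] using h

theorem HasFiniteLevels.finite_add_closure_singleton {F : Set Γ} {t : Γ} (hF : F.Finite)
    (ht : deg t = 0) (hN : HasFiniteLevels deg (F + (AddSubmonoid.closure {t} : Set Γ))) :
    (F + (AddSubmonoid.closure {t} : Set Γ)).Finite := by
  refine hN.finite_of_finite_image ((hF.image deg).subset ?_)
  rintro _ ⟨_, ⟨f, hf, m, hm, rfl⟩, rfl⟩
  obtain ⟨k, rfl⟩ := AddSubmonoid.mem_closure_singleton.1 hm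
  exact ⟨f, hf, by simp only [map_add, map_nsmul, ht, smul_zero, add_zero]⟩

/-- The set `C` is there for the induction on the generators `T`: translating by a new generator
turns `N` into `N` with a stable set removed. -/
theorem growthSeries_add_closure_sdiff_mem [IsCancelAdd Γ] {F T : Set Γ} (hF : F.Finite)
    (hT : T.Finite) (hN : HasFiniteLevels deg (F + (AddSubmonoid.closure T : Set Γ))) {C : Set Γ}
    (hC : C + (AddSubmonoid.closure T : Set Γ) ⊆ C) :
    growthSeries deg ((F + (AddSubmonoid.closure T : Set Γ)) \ C) ∈ rationalSeries ℚ := by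
  induction T, hT using Set.Finite.induction_on generalizing F C with
  | empty =>
    rw [AddSubmonoid.closure_empty, AddSubmonoid.coe_bot, Set.singleton_zero, add_zero]
    exact (HasRationalGrowth.of_finite deg (hF.subset Set.sdiff_subset)).growthSeries_mem
  | @insert t T _ hT ih =>
    have hTM : AddSubmonoid.closure T ≤ AddSubmonoid.closure (insert t T) :=
      AddSubmonoid.closure_mono (Set.subset_insert t T)
    rcases (deg t).eq_zero_or_pos with ht | ht
    · have hFt : (F + (AddSubmonoid.closure {t} : Set Γ)).Finite :=
        (hN.mono (Set.add_subset_add_left (AddSubmonoid.closure_mono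
          (Set.singleton_subset_iff.2 (Set.mem_insert t T))))).finite_add_closure_singleton hF ht
      rw [add_closure_insert] at hN ⊢
      exact ih hFt hN ((Set.add_subset_add_left hTM).trans hC)
    · exact growthSeries_sdiff_mem_of_deg_pos hF hT ht hN
        (fun _ => ih hF (hN.mono (Set.add_subset_add_left hTM))) hC

theorem IsFGTranslateSet.hasRationalGrowth [IsCancelAdd Γ] {A : Set Γ} (hA : IsFGTranslateSet A)
    (hfin : HasFiniteLevels deg A) : HasRationalGrowth deg A := by
  obtain ⟨F, M, hF, hM, rfl⟩ := hA
  obtain ⟨T, rfl, hT⟩ := (AddSubmonoid.fg_iff M).1 hM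
  have h := growthSeries_add_closure_sdiff_mem hF hT hfin (C := ∅)
    (by rw [Set.empty_add])
  exact ⟨hfin, by rwa [Set.sdiff_empty] at h⟩

theorem HasFiniteLevels.hasRationalGrowth_of_isSemilinearSet [IsCancelAdd Γ] {A : Set Γ}
    (hfin : HasFiniteLevels deg A) (hA : IsSemilinearSet A) : HasRationalGrowth deg A := by
  obtain ⟨𝒜, h𝒜, hlin, rfl⟩ := hA
  exact HasRationalGrowth.sUnion_of_inter
    (C := fun A => IsFGTranslateSet A ∧ HasFiniteLevels deg A)
    (fun A h => h.1.hasRationalGrowth h.2)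
    (fun A B hA hB => ⟨hA.1.inter hB.1, hA.2.mono Set.inter_subset_left⟩) h𝒜
    fun A hA => ⟨.of_isLinearSet (hlin A hA), hfin.mono (Set.subset_sUnion_of_mem hA)⟩

end SemilinearGrowth

section RemovableBlock

variable {Q : Type*} [Finite Q] (f : ℕ → Q)

theorem exists_window_without_first_occurrence :
    ∃ a ≤ Nat.card Q, ∀ t, a * Nat.card Q < t → t ≤ a * Nat.card Q + Nat.card Q →
      ∃ t' < t, f t' = f t := by
  by_contra! h
  set n := Nat.card Q
  choose! τ hlt hle hfirst using h
  have hne (a b : ℕ) (ha : a ≤ n) (hb : b ≤ n) (hab : a < b) : f (τ a) ≠ f (τ b) := by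
    refine hfirst b hb (τ a) ?_
    calc τ a ≤ a * n + n := hle a ha
      _ = (a + 1) * n := (Nat.succ_mul a n).symm
      _ ≤ b * n := Nat.mul_le_mul_right n hab
      _ < τ b := hlt b hb
  have hinj : Function.Injective fun a : Fin (n + 1) => f (τ a) := by
    intro a b heq
    by_contra hab
    rcases Fin.lt_or_lt_of_ne hab with hab | hab
    · exact hne a b a.is_le b.is_le hab heq
    · exact hne b a b.is_le a.is_le hab heq.symm
  have hcard := Nat.card_le_card_of_injective _ hinj
  rw [Nat.card_fin] at hcard
  exact absurd hcard (Nat.not_succ_le_self n)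

theorem exists_lt_le_add_card_eq (k : ℕ) :
    ∃ i j, k ≤ i ∧ i < j ∧ j ≤ k + Nat.card Q ∧ f i = f j := by
  obtain ⟨x, y, hxy, heq⟩ : ∃ x y : Fin (Nat.card Q + 1), x ≠ y ∧ f (k + x) = f (k + y) := by
    have := Fintype.ofFinite Q
    exact Fintype.exists_ne_map_eq_of_card_lt (fun x : Fin (Nat.card Q + 1) => f (k + x))
      (by rw [Fintype.card_fin, Nat.card_eq_fintype_card]; exact Nat.lt_succ_self _)
  wlog h : x < y generalizing x y
  · exact this y x hxy.symm heq.symm ((Fin.lt_or_lt_of_ne hxy).resolve_left h)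
  · exact ⟨k + x, k + y, by omega, by omega, by omega, heq⟩

/-- The block lies in a window free of first occurrences, so that removing it loses no value. -/
theorem exists_removable_block :
    ∃ i j, i < j ∧ j ≤ i + Nat.card Q ∧ j ≤ Nat.card Q * (Nat.card Q + 1) ∧ f i = f j ∧
      ∀ t, ∃ t', f t' = f t ∧ (t' ≤ i ∨ j < t') := by
  classical
  obtain ⟨a, ha, hwindow⟩ := exists_window_without_first_occurrence f
  obtain ⟨i, j, hi, hij, hj, heq⟩ := exists_lt_le_add_card_eq f (a * Nat.card Q)
  have haQ := Nat.mul_le_mul_right (Nat.card Q) ha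
  refine ⟨i, j, hij, by omega, by rw [Nat.mul_succ]; omega, heq, fun t => ?_⟩
  have hex : ∃ t', f t' = f t := ⟨t, rfl⟩
  refine ⟨Nat.find hex, Nat.find_spec hex, ?_⟩
  by_contra! h
  obtain ⟨t', ht', hft'⟩ := hwindow (Nat.find hex) (by omega) (by omega)
  exact Nat.find_min hex ht' (hft'.trans (Nat.find_spec hex))

end RemovableBlock

section Balls

variable {V : Type*} {G : SimpleGraph V} {u v : V}

theorem edist_le_natCast_iff {k : ℕ} : G.edist u v ≤ k ↔ ∃ p : G.Walk u v, p.length ≤ k := by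
  constructor
  · intro h
    obtain ⟨p, hp⟩ :=
      SimpleGraph.exists_walk_of_edist_ne_top (h.trans_lt (ENat.natCast_lt_top k)).ne
    exact ⟨p, by rw [← hp] at h; exact_mod_cast h⟩
  · rintro ⟨p, hp⟩
    exact p.edist_le.trans (by exact_mod_cast hp)

theorem finite_setOf_edist_le (hfin : ∀ v, G.Reachable u v → (G.neighborSet v).Finite) (n : ℕ) :
    {v | G.edist u v ≤ n}.Finite := by
  simp only [edist_le_natCast_iff]
  induction n generalizing u with
  | zero =>
    refine (Set.finite_singleton u).subset ?_
    rintro v ⟨p, hp⟩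
    exact (SimpleGraph.Walk.eq_of_length_eq_zero (Nat.le_zero.1 hp)).symm
  | succ n ih =>
    refine ((Set.finite_singleton u).union ((hfin u (.refl u)).biUnion
      fun t ht => ih (u := t) fun v hv => hfin v (ht.reachable.trans hv))).subset ?_
    rintro v ⟨p, hp⟩
    cases p with
    | nil => exact Or.inl rfl
    | cons h p => exact Or.inr (Set.mem_biUnion h ⟨p, Nat.le_of_succ_le_succ hp⟩)

end Balls

section Orbits

variable {A V : Type*} [AddGroup A] [AddAction A V]

/-- The orbit of `v`, as an element of the orbit space. -/
def orbitClass (A : Type*) {V : Type*} [AddGroup A] [AddAction A V] (v : V) :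
    AddAction.orbitRel.Quotient A V :=
  Quotient.mk _ v

theorem orbitClass_eq_iff {u v : V} : orbitClass A u = orbitClass A v ↔ ∃ g : A, g +ᵥ v = u :=
  Quotient.eq.trans AddAction.orbitRel_apply

theorem orbitClass_vadd (g : A) (v : V) : orbitClass A (g +ᵥ v) = orbitClass A v :=
  orbitClass_eq_iff.2 ⟨g, rfl⟩

end Orbits

section InvariantGraph

variable {A V : Type*} [AddGroup A] [AddAction A V] {G : SimpleGraph V} {u v w v₀ : V}

/-- The action of `A` on `V` maps edges of `G` to edges. -/
def IsVAddInvariant (A : Type*) {V : Type*} [AddGroup A] [AddAction A V] (G : SimpleGraph V) :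
    Prop :=
  ∀ (g : A) (u w : V), G.Adj u w → G.Adj (g +ᵥ u) (g +ᵥ w)

/-- The image of a walk under the action of `g`. -/
def IsVAddInvariant.translateWalk (hG : IsVAddInvariant A G) (g : A) (p : G.Walk u v) :
    G.Walk (g +ᵥ u) (g +ᵥ v) :=
  p.map ⟨(g +ᵥ ·), fun h => hG g _ _ h⟩

theorem IsVAddInvariant.length_translateWalk (hG : IsVAddInvariant A G) (g : A) (p : G.Walk u v) :
    (hG.translateWalk g p).length = p.length :=
  p.length_map _

/-- The set of orbits met by a walk. -/
def visitedOrbits (A : Type*) {V : Type*} [AddGroup A] [AddAction A V] {G : SimpleGraph V}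
    {u v : V} (p : G.Walk u v) : Set (AddAction.orbitRel.Quotient A V) :=
  orbitClass A '' {x | x ∈ p.support}

theorem orbitClass_end_mem_visitedOrbits (p : G.Walk u v) :
    orbitClass A v ∈ visitedOrbits A p :=
  ⟨v, p.end_mem_support, rfl⟩

theorem visitedOrbits_eq_range (p : G.Walk u v) :
    visitedOrbits A p = Set.range fun t => orbitClass A (p.getVert t) := by
  ext q
  constructor
  · rintro ⟨x, hx, rfl⟩
    obtain ⟨t, rfl, -⟩ := SimpleGraph.Walk.mem_support_iff_exists_getVert.1 hx
    exact ⟨t, rfl⟩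
  · rintro ⟨t, rfl⟩
    exact ⟨_, p.getVert_mem_support t, rfl⟩

theorem visitedOrbits_append (p : G.Walk u v) (q : G.Walk v w) :
    visitedOrbits A (p.append q) = visitedOrbits A p ∪ visitedOrbits A q := by
  rw [visitedOrbits, visitedOrbits, visitedOrbits, ← Set.image_union]
  simp only [SimpleGraph.Walk.mem_support_append_iff]
  rfl

theorem visitedOrbits_copy {u' v' : V} (p : G.Walk u v) (hu : u = u') (hv : v = v') :
    visitedOrbits A (p.copy hu hv) = visitedOrbits A p := by
  rw [visitedOrbits, SimpleGraph.Walk.support_copy]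
  rfl

theorem IsVAddInvariant.visitedOrbits_translateWalk (hG : IsVAddInvariant A G) (g : A)
    (p : G.Walk u v) : visitedOrbits A (hG.translateWalk g p) = visitedOrbits A p := by
  simp only [visitedOrbits_eq_range, translateWalk, SimpleGraph.Walk.getVert_map,
    RelHom.coeFn_mk, orbitClass_vadd]

/-- There is a walk of length at most `k` from `u` to `v` that meets every orbit in `S`. -/
def VisitingWalk (G : SimpleGraph V) (S : Set (AddAction.orbitRel.Quotient A V)) (k : ℕ)
    (u v : V) : Prop :=
  ∃ p : G.Walk u v, p.length ≤ k ∧ S ⊆ visitedOrbits A p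

/-- The pairs of a translation in `D` and a length at most `n` such that a walk of at most that
length takes some vertex with orbit in `S` to its translate. -/
def translationSteps (G : SimpleGraph V) (D : Set A)
    (S : Set (AddAction.orbitRel.Quotient A V)) (n : ℕ) : Set (A × ℕ) :=
  {m | m.1 ∈ D ∧ m.2 ≤ n ∧ ∃ s, orbitClass A s ∈ S ∧ G.edist s (m.1 +ᵥ s) ≤ m.2}

/-- The translations in `D` account for all pairs of vertices of an orbit that can be reached from
`v₀` and are at distance at most `n`. -/
def IsDisplacementSet (G : SimpleGraph V) (v₀ : V) (n : ℕ) (D : Set A) : Prop :=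
  ∀ x y, G.Reachable v₀ x → orbitClass A x = orbitClass A y → G.edist x y ≤ n →
    ∃ g ∈ D, g +ᵥ x = y

variable {D : Set A} {S : Set (AddAction.orbitRel.Quotient A V)} {n k : ℕ}

theorem finite_translationSteps (hD : D.Finite) : (translationSteps G D S n).Finite :=
  (hD.prod (Set.finite_Iic n)).subset fun _ hm => ⟨hm.1, hm.2.1⟩

theorem IsVAddInvariant.edist_vadd_le (hG : IsVAddInvariant A G) (g : A) (h : G.edist u v ≤ n) :
    G.edist (g +ᵥ u) (g +ᵥ v) ≤ n := by
  obtain ⟨p, hp⟩ := edist_le_natCast_iff.1 h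
  exact edist_le_natCast_iff.2 ⟨hG.translateWalk g p, (hG.length_translateWalk g p).trans_le hp⟩

theorem IsVAddInvariant.exists_walk_excising (hG : IsVAddInvariant A G) (p : G.Walk u v) {i j : ℕ}
    {g : A} (hg : g +ᵥ p.getVert i = p.getVert j) (hij : i ≤ j) (hj : j ≤ p.length)
    (hocc : ∀ t, ∃ t', orbitClass A (p.getVert t') = orbitClass A (p.getVert t) ∧
      (t' ≤ i ∨ j < t')) :
    ∃ p' : G.Walk u (-g +ᵥ v), p'.length + (j - i) = p.length ∧
      visitedOrbits A p' = visitedOrbits A p := by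
  have hback : -g +ᵥ p.getVert j = p.getVert i := by rw [← hg, neg_vadd_vadd]
  refine ⟨(p.take i).append ((hG.translateWalk (-g) (p.drop j)).copy hback rfl), ?_, ?_⟩
  · simp only [SimpleGraph.Walk.length_append, SimpleGraph.Walk.length_copy,
      hG.length_translateWalk, SimpleGraph.Walk.take_length, SimpleGraph.Walk.drop_length]
    omega
  · rw [visitedOrbits_append, visitedOrbits_copy, hG.visitedOrbits_translateWalk]
    simp only [visitedOrbits_eq_range, SimpleGraph.Walk.take_getVert,
      SimpleGraph.Walk.drop_getVert]
    refine Set.Subset.antisymm (Set.union_subset ?_ ?_) ?_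
    · rintro _ ⟨t, rfl⟩
      exact ⟨_, rfl⟩
    · rintro _ ⟨t, rfl⟩
      exact ⟨_, rfl⟩
    · rintro _ ⟨t, rfl⟩
      obtain ⟨t', ht', hpos | hpos⟩ := hocc t
      · exact Or.inl ⟨t', by simpa only [min_eq_right hpos] using ht'⟩
      · exact Or.inr ⟨t' - j, by simpa only [Nat.add_sub_cancel' hpos.le] using ht'⟩

variable [Finite (AddAction.orbitRel.Quotient A V)]

/-- A walk shorter than `k` spends a unit of length by waiting, that is, by a step that fixes its
endpoint; from a walk of length `k` a block is excised. -/
theorem IsVAddInvariant.exists_translationStep (hG : IsVAddInvariant A G)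
    (hn : n = Nat.card (AddAction.orbitRel.Quotient A V)) (hD : IsDisplacementSet G v₀ n D)
    (hk : n * (n + 1) < k) (p : G.Walk v₀ v) (hp : p.length ≤ k) :
    ∃ m ∈ translationSteps G D (visitedOrbits A p) n, 0 < m.2 ∧
      ∃ (v' : V) (p' : G.Walk v₀ v'), m.1 +ᵥ v' = v ∧ p'.length + m.2 ≤ k ∧
        visitedOrbits A p' = visitedOrbits A p := by
  rcases hp.lt_or_eq with hlt | rfl
  · have hdist : G.edist v v = 0 := SimpleGraph.edist_self
    obtain ⟨g, hgD, hgv⟩ := hD v v ⟨p⟩ rfl (hdist.trans_le zero_le)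
    have hn0 : 0 < n := by
      have : Nonempty (AddAction.orbitRel.Quotient A V) := ⟨orbitClass A v⟩
      exact hn ▸ Nat.card_pos
    refine ⟨(g, 1), ⟨hgD, hn0, v, orbitClass_end_mem_visitedOrbits p, ?_⟩, one_pos, v, p, hgv,
      hlt, rfl⟩
    rw [hgv, hdist]
    exact zero_le
  · obtain ⟨i, j, hij, hjn, hjN, heq, hocc⟩ :=
      exists_removable_block fun t => orbitClass A (p.getVert t)
    rw [← hn] at hjn hjN
    have hdist : G.edist (p.getVert i) (p.getVert j) ≤ (j - i : ℕ) := by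
      refine edist_le_natCast_iff.2 ⟨((p.drop i).take (j - i)).copy rfl ?_, ?_⟩
      · rw [SimpleGraph.Walk.drop_getVert, Nat.add_sub_cancel' hij.le]
      · rw [SimpleGraph.Walk.length_copy, SimpleGraph.Walk.take_length]
        exact min_le_left _ _
    obtain ⟨g, hgD, hg⟩ := hD _ _ ⟨p.take i⟩ heq
      (hdist.trans (Nat.cast_le.2 (Nat.sub_le_iff_le_add'.2 hjn)))
    obtain ⟨p', hlen, hvis⟩ :=
      hG.exists_walk_excising p hg hij.le (hjN.trans hk.le) hocc
    refine ⟨(g, j - i), ⟨hgD, Nat.sub_le_iff_le_add'.2 hjn, p.getVert i, ?_, hg ▸ hdist⟩,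
      Nat.sub_pos_of_lt hij, -g +ᵥ v, p', vadd_neg_vadd g v, hlen.le, hvis⟩
    exact ⟨_, p.getVert_mem_support i, rfl⟩

theorem IsVAddInvariant.exists_mem_closure_translationSteps (hG : IsVAddInvariant A G)
    (hn : n = Nat.card (AddAction.orbitRel.Quotient A V)) (hD : IsDisplacementSet G v₀ n D)
    (p : G.Walk v₀ v) (hp : p.length ≤ k) :
    ∃ m ∈ AddSubmonoid.closure (translationSteps G D (visitedOrbits A p) n),
      ∃ (l : ℕ) (v' : V), l ≤ n * (n + 1) ∧ VisitingWalk G (visitedOrbits A p) l v₀ v' ∧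
        m.1 +ᵥ v' = v ∧ m.2 + l = k := by
  induction k using Nat.strong_induction_on generalizing v with
  | _ k ih =>
    rcases le_or_gt k (n * (n + 1)) with hk | hk
    · exact ⟨0, zero_mem _, k, v, hk, ⟨p, hp, subset_rfl⟩, zero_vadd _ v, zero_add k⟩
    · obtain ⟨m, hm, hpos, v', p', rfl, hlen, hvis⟩ := hG.exists_translationStep hn hD hk p hp
      obtain ⟨m', hm', l, v'', hl, hv'', rfl, hlm⟩ :=
        ih (k - m.2) (by omega) p' (Nat.le_sub_of_add_le hlen)
      rw [hvis] at hm' hv''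
      refine ⟨m + m', add_mem (AddSubmonoid.subset_closure hm) hm', l, v'', hl, hv'',
        add_vadd _ _ _, ?_⟩
      rw [Prod.snd_add]
      omega

end InvariantGraph

section CommutingTranslations

variable {A V : Type*} [AddCommGroup A] [AddAction A V] {G : SimpleGraph V} {u v v₀ : V}
  {D : Set A} {S : Set (AddAction.orbitRel.Quotient A V)} {n k : ℕ}

theorem IsVAddInvariant.exists_finite_isDisplacementSet
    [Finite (AddAction.orbitRel.Quotient A V)] (hG : IsVAddInvariant A G)
    (hfin : ∀ v, G.Reachable v₀ v → (G.neighborSet v).Finite) (n : ℕ) :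
    ∃ D : Set A, D.Finite ∧ IsDisplacementSet G v₀ n D := by
  have horbit (q : AddAction.orbitRel.Quotient A V) : ∃ D : Set A, D.Finite ∧
      ∀ x y, G.Reachable v₀ x → orbitClass A x = q → orbitClass A y = q → G.edist x y ≤ n →
        ∃ g ∈ D, g +ᵥ x = y := by
    by_cases hq : ∃ s, G.Reachable v₀ s ∧ orbitClass A s = q
    · obtain ⟨s, hs, rfl⟩ := hq
      have htrans (y) (hy : orbitClass A y = orbitClass A s) : ∃ g : A, g +ᵥ s = y :=
        orbitClass_eq_iff.1 hy
      choose! γ hγ using htrans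
      refine ⟨γ '' {y | G.edist s y ≤ n},
        (finite_setOf_edist_le (fun v hv => hfin v (hs.trans hv)) n).image γ, ?_⟩
      intro x y _ hxs hys hxy
      obtain ⟨h, rfl⟩ := orbitClass_eq_iff.1 hxs
      have hball := hG.edist_vadd_le (-h) hxy
      rw [neg_vadd_vadd] at hball
      refine ⟨_, Set.mem_image_of_mem γ hball, ?_⟩
      rw [vadd_comm, hγ _ ((orbitClass_vadd _ _).trans hys), vadd_neg_vadd]
    · exact ⟨∅, Set.finite_empty, fun x _ hx hxq => absurd ⟨x, hx, hxq⟩ hq⟩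
  choose D hDfin hD using horbit
  refine ⟨⋃ q, D q, Set.finite_iUnion hDfin, fun x y hx hxy hle => ?_⟩
  obtain ⟨g, hg, hgx⟩ := hD _ x y hx rfl hxy.symm hle
  exact ⟨g, Set.mem_iUnion_of_mem _ hg, hgx⟩

theorem VisitingWalk.vadd_of_mem_translationSteps (hG : IsVAddInvariant A G)
    (hv : VisitingWalk G S k u v) {m : A × ℕ} (hm : m ∈ translationSteps G D S n) :
    VisitingWalk G S (k + m.2) u (m.1 +ᵥ v) := by
  classical
  obtain ⟨p, hpk, hpS⟩ := hv
  obtain ⟨-, -, s, hs, hsm⟩ := hm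
  obtain ⟨c, hc⟩ := edist_le_natCast_iff.1 hsm
  obtain ⟨x, hx, hxs⟩ := hpS hs
  obtain ⟨h, rfl⟩ := orbitClass_eq_iff.1 hxs
  refine ⟨((p.takeUntil _ hx).append ((hG.translateWalk h c).copy rfl (vadd_comm h m.1 s))).append
    (hG.translateWalk m.1 (p.dropUntil _ hx)), ?_, hpS.trans ?_⟩
  · have hlen := congrArg SimpleGraph.Walk.length (p.take_spec hx)
    simp only [SimpleGraph.Walk.length_append, SimpleGraph.Walk.length_copy,
      hG.length_translateWalk] at hlen ⊢
    omega
  · conv_lhs => rw [← p.take_spec hx]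
    simp only [visitedOrbits_append, hG.visitedOrbits_translateWalk]
    exact Set.union_subset_union_left _ Set.subset_union_left

theorem VisitingWalk.vadd_of_mem_closure (hG : IsVAddInvariant A G)
    (hv : VisitingWalk G S k u v) {m : A × ℕ}
    (hm : m ∈ AddSubmonoid.closure (translationSteps G D S n)) :
    VisitingWalk G S (k + m.2) u (m.1 +ᵥ v) := by
  induction hm using AddSubmonoid.closure_induction generalizing k v with
  | mem x hx => exact hv.vadd_of_mem_translationSteps hG hx
  | zero => rwa [Prod.snd_zero, Prod.fst_zero, add_zero, zero_vadd]
  | add x y _ _ hx hy =>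
    have h := hx (hy hv)
    rwa [add_assoc, add_comm y.2, vadd_vadd] at h

end CommutingTranslations

section BallGrowth

variable {A V : Type*} [AddCommGroup A] [AddAction A V] {G : SimpleGraph V} {v₀ : V}

open AddAction

theorem ofQuotientStabilizer_mk_add (g : A) (r : V) (x : A ⧸ stabilizer A r) :
    ofQuotientStabilizer A r (g + x) = g +ᵥ ofQuotientStabilizer A r x :=
  ofQuotientStabilizer_vadd A r g x

theorem hasFiniteLevels_setOf_edist_le {α : Type*} {e : α → V} (he : Function.Injective e)
    (hfin : ∀ v, G.Reachable v₀ v → (G.neighborSet v).Finite) :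
    HasFiniteLevels Prod.snd {m : α × ℕ | G.edist v₀ (e m.1) ≤ m.2} := by
  intro k
  refine (((finite_setOf_edist_le hfin k).preimage he.injOn).prod (Set.finite_singleton k)).subset
    ?_
  rintro ⟨x, k⟩ ⟨hx, rfl⟩
  exact ⟨hx, rfl⟩

theorem finite_setOf_visitingWalk {α : Type*} {e : α → V} (he : Function.Injective e)
    (hfin : ∀ v, G.Reachable v₀ v → (G.neighborSet v).Finite) (S : Set (orbitRel.Quotient A V))
    (N : ℕ) : {m : α × ℕ | m.2 ≤ N ∧ VisitingWalk G S m.2 v₀ (e m.1)}.Finite := by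
  refine ((hasFiniteLevels_setOf_edist_le he hfin).mono ?_).finite_of_finite_image
    ((Set.finite_Iic N).subset ?_)
  · rintro m ⟨-, p, hp, -⟩
    exact edist_le_natCast_iff.2 ⟨p, hp⟩
  · rintro _ ⟨m, ⟨hm, -⟩, rfl⟩
    exact hm

theorem IsVAddInvariant.isSemilinearSet_setOf_edist_le [Finite (orbitRel.Quotient A V)]
    (hG : IsVAddInvariant A G) (hfin : ∀ v, G.Reachable v₀ v → (G.neighborSet v).Finite) (r : V) :
    IsSemilinearSet {m : (A ⧸ stabilizer A r) × ℕ |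
      G.edist v₀ (ofQuotientStabilizer A r m.1) ≤ m.2} := by
  obtain ⟨n, hn⟩ : ∃ n, n = Nat.card (orbitRel.Quotient A V) := ⟨_, rfl⟩
  obtain ⟨D, hDfin, hD⟩ := hG.exists_finite_isDisplacementSet hfin n
  let π : A × ℕ →+ (A ⧸ stabilizer A r) × ℕ :=
    (QuotientAddGroup.mk' (stabilizer A r)).prodMap (AddMonoidHom.id ℕ)
  let short (S : Set (orbitRel.Quotient A V)) : Set ((A ⧸ stabilizer A r) × ℕ) :=
    {m | m.2 ≤ n * (n + 1) ∧ VisitingWalk G S m.2 v₀ (ofQuotientStabilizer A r m.1)}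
  have hshort (S) : (short S).Finite :=
    finite_setOf_visitingWalk (injective_ofQuotientStabilizer A r) hfin S _
  suffices {m : (A ⧸ stabilizer A r) × ℕ | G.edist v₀ (ofQuotientStabilizer A r m.1) ≤ m.2} =
      ⋃ S, short S + π '' (AddSubmonoid.closure (translationSteps G D S n) : Set (A × ℕ)) by
    rw [this]
    exact .iUnion fun S => (IsSemilinearSet.of_finite (hshort S)).add
      ((IsSemilinearSet.closure_of_finite (finite_translationSteps hDfin)).image π)
  refine Set.Subset.antisymm (fun m hm => ?_) (Set.iUnion_subset fun S => ?_)
  · obtain ⟨x, k⟩ := m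
    obtain ⟨p, hp⟩ := edist_le_natCast_iff.1 hm
    obtain ⟨m, hm, l, v', hl, hv', hmv, rfl⟩ :=
      hG.exists_mem_closure_translationSteps hn hD p hp
    have hback : ofQuotientStabilizer A r ((-m.1 : A) + x) = v' :=
      (ofQuotientStabilizer_mk_add _ _ _).trans (neg_vadd_eq_iff.2 hmv.symm)
    refine Set.mem_iUnion.2 ⟨visitedOrbits A p, ((-m.1 : A) + x, l), ⟨hl, ?_⟩, _,
      Set.mem_image_of_mem π hm, Prod.ext ?_ (add_comm l m.2)⟩
    · rwa [hback]
    · exact neg_add_cancel_comm _ _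
  · rintro _ ⟨⟨x, l⟩, ⟨-, hv⟩, _, ⟨m, hm, rfl⟩, rfl⟩
    obtain ⟨p, hp, -⟩ := hv.vadd_of_mem_closure hG hm
    refine edist_le_natCast_iff.2 ⟨p.copy rfl ?_, (p.length_copy _ _).trans_le hp⟩
    rw [← ofQuotientStabilizer_mk_add, add_comm]
    rfl

theorem IsVAddInvariant.hasRationalGrowth_setOf_edist_le [Finite (orbitRel.Quotient A V)]
    (hG : IsVAddInvariant A G) (hfin : ∀ v, G.Reachable v₀ v → (G.neighborSet v).Finite) :
    HasRationalGrowth Prod.snd {x : V × ℕ | G.edist v₀ x.1 ≤ x.2} := by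
  let e (q : orbitRel.Quotient A V) := ofQuotientStabilizer A q.out
  have he (q) : Function.Injective (e q) := injective_ofQuotientStabilizer A q.out
  have horbit (q) (x) : orbitClass A (e q x) = q := by
    obtain ⟨g, rfl⟩ := QuotientAddGroup.mk_surjective x
    exact (orbitClass_vadd g q.out).trans q.out_eq
  have hunion : {x : V × ℕ | G.edist v₀ x.1 ≤ x.2} =
      ⋃ q, Prod.map (e q) id ''
        {m : (A ⧸ stabilizer A q.out) × ℕ | G.edist v₀ (e q m.1) ≤ m.2} := by
    refine Set.Subset.antisymm (fun ⟨v, k⟩ hv => ?_) (Set.iUnion_subset fun q => ?_)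
    · obtain ⟨g, hg⟩ := orbitClass_eq_iff.1 (Quotient.out_eq (orbitClass A v)).symm
      exact Set.mem_iUnion.2
        ⟨_, (g, k), (congrArg (G.edist v₀) hg).trans_le hv, Prod.ext hg rfl⟩
    · rintro _ ⟨m, hm, rfl⟩
      exact hm
  rw [hunion]
  refine .iUnion_of_pairwise_disjoint (fun q => ?_) fun q q' hqq' => ?_
  · have h := (hasFiniteLevels_setOf_edist_le (he q) hfin).hasRationalGrowth_of_isSemilinearSet
      (deg := AddMonoidHom.snd _ ℕ) (hG.isSemilinearSet_setOf_edist_le hfin q.out)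
    exact h.image (c := 0) ((he q).prodMap Function.injective_id).injOn fun _ _ => rfl
  · refine Set.disjoint_left.2 ?_
    rintro _ ⟨m, -, rfl⟩ ⟨m', -, heq⟩
    exact hqq' ((horbit q m.1).symm.trans
      ((congrArg (orbitClass A) (congrArg Prod.fst heq)).symm.trans (horbit q' m'.1)))

theorem setOf_edist_eq_eq_sdiff (G : SimpleGraph V) (v₀ : V) :
    {x : V × ℕ | G.edist v₀ x.1 = x.2} =
      {x | G.edist v₀ x.1 ≤ x.2} \ Prod.map id Nat.succ '' {x | G.edist v₀ x.1 ≤ x.2} := by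
  ext ⟨v, k⟩
  refine ⟨fun h => ⟨h.le, ?_⟩, fun ⟨hle, hnot⟩ => hle.antisymm (not_lt.1 fun hlt => hnot ?_)⟩
  · rintro ⟨⟨w, l⟩, hl, heq⟩
    obtain ⟨rfl, rfl⟩ := Prod.mk.inj heq
    have hl' : G.edist v₀ w ≤ l := hl
    rw [show G.edist v₀ w = (l + 1 : ℕ) from h, Nat.cast_le] at hl'
    exact Nat.not_succ_le_self l hl'
  · cases k with
    | zero => exact absurd hlt not_lt_zero
    | succ k => exact ⟨(v, k), ENat.lt_add_one_iff (ENat.natCast_ne_top k) |>.1 hlt, rfl⟩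

theorem HasRationalGrowth.setOf_edist_eq
    (h : HasRationalGrowth Prod.snd {x : V × ℕ | G.edist v₀ x.1 ≤ x.2}) :
    HasRationalGrowth Prod.snd {x : V × ℕ | G.edist v₀ x.1 = x.2} := by
  rw [setOf_edist_eq_eq_sdiff]
  refine h.sdiff (h.image (c := 1)
    (Function.injective_id.prodMap Nat.succ_injective).injOn fun _ _ => rfl) ?_
  rintro _ ⟨⟨v, k⟩, hv, rfl⟩
  exact le_trans (show G.edist v₀ v ≤ k from hv) (Nat.cast_le.2 k.le_succ)

theorem setOf_edist_eq_inter_snd_preimage (G : SimpleGraph V) (v₀ : V) (k : ℕ) :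
    {x : V × ℕ | G.edist v₀ x.1 = x.2} ∩ Prod.snd ⁻¹' {k} = (·, k) '' G.sphereAt v₀ k := by
  ext ⟨v, l⟩
  constructor
  · rintro ⟨hv, rfl⟩
    exact ⟨v, hv, rfl⟩
  · rintro ⟨v, hv, heq⟩
    obtain ⟨rfl, rfl⟩ := Prod.mk.inj heq
    exact ⟨hv, rfl⟩

end BallGrowth

theorem mainTheorem1_general {A V : Type*} [AddCommGroup A] [AddAction A V]
    [Finite (AddAction.orbitRel.Quotient A V)] (G : SimpleGraph V) (hG : IsVAddInvariant A G)
    (v₀ : V) (hfin : ∀ v : V, G.Reachable v₀ v → (G.neighborSet v).Finite) :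
    (∀ k : ℕ, (G.sphereAt v₀ k).Finite) ∧
      (generatingFunction (G.coordinationSequence v₀)).IsRational := by
  have hsphere := (hG.hasRationalGrowth_setOf_edist_le hfin).setOf_edist_eq
  refine ⟨fun k => (finite_setOf_edist_le hfin k).subset fun _ => le_of_eq, ?_⟩
  have hgrowth : generatingFunction (G.coordinationSequence v₀) =
      growthSeries Prod.snd {x : V × ℕ | G.edist v₀ x.1 = x.2} := by
    refine congrArg generatingFunction (funext fun k => ?_)
    rw [setOf_edist_eq_inter_snd_preimage,
      Set.ncard_image_of_injective _ (Prod.mk_left_injective k)]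
    rfl
  rw [hgrowth]
  exact hsphere.growthSeries_mem

theorem mainTheorem1 (d : ℕ) {V : Type*} [AddAction (Fin d → ℤ) V] (G : SimpleGraph V)
    (hG : IsPeriodicGraph d G) (v₀ : V)
    (hfin : ∀ v : V, G.Reachable v₀ v → (G.neighborSet v).Finite) :
    (∀ k : ℕ, (G.sphereAt v₀ k).Finite) ∧
      (generatingFunction (G.coordinationSequence v₀)).IsRational := by
  have := hG.finite_orbits
  exact mainTheorem1_general G hG.adj_vadd v₀ hfin
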